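/- For integers $n, r, s \ge 0$ let $G(n,r,s)$ be the graph whose vertices are the vectors $v \in \{0,1\}^n$ with $\|v\|^2 = r$, two distinct vertices being adjacent if and only if their inner product equals $s$. This graph is regular; write $d(G(n,r,s))$ for its degree. For a graph $G$ on $N$ vertices whose adjacency matrix has eigenvalues $\lambda_1 \ge \lambda_2 \ge \dots \ge \lambda_N$ (with multiplicity), put $\lambda(G) = \max\{|\lambda_2|, \dots, |\lambda_N|\}$. **Theorem.** Fix $\alpha \in (0,1)$ and two functions $f_r, f_s : \mathbb{N} \to \mathbb{R}$ with $f_r(n) = o(n)$ and $f_s(n) = o(n)$ as $n \to \infty$. Then, as $n \to \infty$ through those $n$ for which $\alpha n + f_r(n)$ and $\alpha^2 n + f_s(n)$ are non-negative integers, $$ \lambda\bigl(G(n, \alpha n + f_r(n), \alpha^2 n + f_s(n))\bigr) = O\left(\frac{\max\{1,\ |f_s(n) - 2\alpha f_r(n)|,\ f_r(n)^2/n\}}{n}\, d\bigl(G(n, \alpha n + f_r(n), \alpha^2 n + f_s(n))\bigr)\right), $$ where the implied constant may depend on $\alpha$, $f_r$ and $f_s$. -/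

import Mathlib

open Filter Asymptotics

/-- The vectors `v ∈ {0,1}^n` with `‖v‖² = r`. -/
abbrev JohnsonVertex (n r : ℕ) : Type :=
  {v : Fin n → Fin 2 // ∑ i, (v i : ℕ) ^ 2 = r}

/-- The graph `G(n, r, s)`: two distinct vertices are adjacent iff the inner product of the
corresponding `0/1`-vectors equals `s`. -/
def johnsonGraph (n r s : ℕ) : SimpleGraph (JohnsonVertex n r) where
  Adj v w := v ≠ w ∧ ∑ i, (v.1 i : ℕ) * (w.1 i : ℕ) = s
  symm := ⟨fun v w h => ⟨h.1.symm, by simpa only [mul_comm] using h.2⟩⟩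
  loopless := ⟨fun _ h => h.1 rfl⟩

instance (n r s : ℕ) : DecidableRel (johnsonGraph n r s).Adj := fun v w =>
  inferInstanceAs (Decidable (v ≠ w ∧ ∑ i, (v.1 i : ℕ) * (w.1 i : ℕ) = s))

/-- `graphSpectrum G k` is the eigenvalue `λ_{k+1}` of the adjacency matrix of `G`, where the
eigenvalues are listed with multiplicity in non-increasing order `λ₁ ≥ λ₂ ≥ ⋯`. -/
noncomputable def graphSpectrum {V : Type*} [Fintype V] [DecidableEq V] (G : SimpleGraph V)
    [DecidableRel G.Adj] : Fin (Fintype.card V) → ℝ :=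
  (G.isHermitian_adjMatrix ℝ).eigenvalues₀

/-- `λ(G) = max {|λ₂|, …, |λ_N|}`, where `N` is the number of vertices (and `0` if `N ≤ 1`). -/
noncomputable def secondEigenvalue {V : Type*} [Fintype V] [DecidableEq V] (G : SimpleGraph V)
    [DecidableRel G.Adj] : ℝ :=
  ⨆ k : {k : Fin (Fintype.card V) // 0 < (k : ℕ)}, |graphSpectrum G k.1|

section PairSum

variable {ι : Type*} [DecidableEq ι]

/-- The product of `1[a ∈ W] - 1[b ∈ Z]` over the pairs `(a, b)` in `l`. -/
noncomputable def pairProd (l : List (ι × ι)) (W Z : Finset ι) : ℝ :=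
  (l.map fun e => (if e.1 ∈ W then (1 : ℝ) else 0) - (if e.2 ∈ Z then (1 : ℝ) else 0)).prod

/-- The sum of `pairProd l W Z` over the `s`-subsets `W` of `X` and the `t`-subsets `Z` of `Y`. -/
noncomputable def pairSum (l : List (ι × ι)) (X Y : Finset ι) (s t : ℕ) : ℝ :=
  ∑ W ∈ X.powersetCard s, ∑ Z ∈ Y.powersetCard t, pairProd l W Z

/-- The pairs in `l` match distinct elements of `X` with distinct elements of `Y`. -/
structure IsMatchingList (l : List (ι × ι)) (X Y : Finset ι) : Prop where
  mem : ∀ e ∈ l, e.1 ∈ X ∧ e.2 ∈ Y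
  nodup_fst : (l.map Prod.fst).Nodup
  nodup_snd : (l.map Prod.snd).Nodup

lemma pairProd_nil (W Z : Finset ι) : pairProd [] W Z = 1 := by simp [pairProd]

lemma pairProd_cons (e : ι × ι) (l : List (ι × ι)) (W Z : Finset ι) :
    pairProd (e :: l) W Z =
      ((if e.1 ∈ W then (1 : ℝ) else 0) - (if e.2 ∈ Z then (1 : ℝ) else 0)) * pairProd l W Z := by
  simp [pairProd]

lemma pairProd_congr {l : List (ι × ι)} {W W' Z Z' : Finset ι}
    (h : ∀ e ∈ l, (e.1 ∈ W ↔ e.1 ∈ W') ∧ (e.2 ∈ Z ↔ e.2 ∈ Z')) :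
    pairProd l W Z = pairProd l W' Z' := by
  unfold pairProd
  congr 1
  apply List.map_congr_left
  intro e he
  simp only [h e he]

lemma abs_pairProd_le (l : List (ι × ι)) (W Z : Finset ι) : |pairProd l W Z| ≤ 1 := by
  induction l with
  | nil => simp [pairProd_nil]
  | cons e l ih =>
    rw [pairProd_cons, abs_mul]
    refine mul_le_one₀ ?_ (abs_nonneg _) ih
    split_ifs <;> norm_num

lemma pairSum_nil (X Y : Finset ι) (s t : ℕ) :
    pairSum [] X Y s t = X.card.choose s * Y.card.choose t := by
  simp [pairSum, pairProd_nil]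

lemma abs_pairSum_le (l : List (ι × ι)) (X Y : Finset ι) (s t : ℕ) :
    |pairSum l X Y s t| ≤ X.card.choose s * Y.card.choose t := by
  rw [← pairSum_nil, pairSum, pairSum]
  refine (Finset.abs_sum_le_sum_abs _ _).trans (Finset.sum_le_sum fun W _ => ?_)
  refine (Finset.abs_sum_le_sum_abs _ _).trans (Finset.sum_le_sum fun Z _ => ?_)
  rw [pairProd_nil]
  exact abs_pairProd_le l W Z

lemma sum_powersetCard_insert {a : ι} {X : Finset ι} (ha : a ∉ X) (s : ℕ) (g : Finset ι → ℝ) :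
    ∑ W ∈ (insert a X).powersetCard (s + 1), g W =
      ∑ W ∈ X.powersetCard (s + 1), g W + ∑ W ∈ X.powersetCard s, g (insert a W) := by
  rw [Finset.powersetCard_succ_insert ha, Finset.sum_union, Finset.sum_image]
  · intro W hW W' hW' h
    have h1 : a ∉ W := fun h' => ha ((Finset.mem_powersetCard.1 hW).1 h')
    have h2 : a ∉ W' := fun h' => ha ((Finset.mem_powersetCard.1 hW').1 h')
    rw [← Finset.erase_insert h1, ← Finset.erase_insert h2, h]
  · rw [Finset.disjoint_left]
    intro W hW hW'
    obtain ⟨W', -, rfl⟩ := Finset.mem_image.1 hW'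
    exact ha ((Finset.mem_powersetCard.1 hW).1 (Finset.mem_insert_self a W'))

lemma pairSum_cons {a b : ι} {l : List (ι × ι)} {X Y : Finset ι} (ha : a ∉ X) (hb : b ∉ Y)
    (hl : ∀ e ∈ l, e.1 ≠ a ∧ e.2 ≠ b) (s t : ℕ) :
    pairSum ((a, b) :: l) (insert a X) (insert b Y) (s + 1) (t + 1) =
      pairSum l X Y s (t + 1) - pairSum l X Y (s + 1) t := by
  have hXa : ∀ {k W}, W ∈ X.powersetCard k → a ∉ W := fun hW h' =>
    ha ((Finset.mem_powersetCard.1 hW).1 h')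
  have hYb : ∀ {k Z}, Z ∈ Y.powersetCard k → b ∉ Z := fun hZ h' =>
    hb ((Finset.mem_powersetCard.1 hZ).1 h')
  have e1 : ∀ W Z, pairProd l (insert a W) Z = pairProd l W Z := fun W Z =>
    pairProd_congr fun e he => ⟨by simp [(hl e he).1], Iff.rfl⟩
  have e2 : ∀ W Z, pairProd l W (insert b Z) = pairProd l W Z := fun W Z =>
    pairProd_congr fun e he => ⟨Iff.rfl, by simp [(hl e he).2]⟩
  unfold pairSum
  rw [sum_powersetCard_insert ha]
  simp_rw [sum_powersetCard_insert hb]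
  have z1 : ∀ W ∈ X.powersetCard (s + 1),
      (∑ Z ∈ Y.powersetCard (t + 1), pairProd ((a, b) :: l) W Z +
        ∑ Z ∈ Y.powersetCard t, pairProd ((a, b) :: l) W (insert b Z)) =
        -∑ Z ∈ Y.powersetCard t, pairProd l W Z := by
    intro W hW
    rw [Finset.sum_eq_zero, zero_add, ← Finset.sum_neg_distrib]
    · refine Finset.sum_congr rfl fun Z hZ => ?_
      simp [pairProd_cons, hXa hW, e2]
    · intro Z hZ
      simp [pairProd_cons, hXa hW, hYb hZ]
  have z2 : ∀ W ∈ X.powersetCard s,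
      (∑ Z ∈ Y.powersetCard (t + 1), pairProd ((a, b) :: l) (insert a W) Z +
        ∑ Z ∈ Y.powersetCard t, pairProd ((a, b) :: l) (insert a W) (insert b Z)) =
        ∑ Z ∈ Y.powersetCard (t + 1), pairProd l W Z := by
    intro W hW
    rw [add_comm, Finset.sum_eq_zero, zero_add]
    · refine Finset.sum_congr rfl fun Z hZ => ?_
      simp [pairProd_cons, hYb hZ, e1]
    · intro Z hZ
      simp [pairProd_cons]
  rw [Finset.sum_congr rfl z1, Finset.sum_congr rfl z2, Finset.sum_neg_distrib]
  ring

lemma IsMatchingList.exists_insert {a b : ι} {l : List (ι × ι)} {X Y : Finset ι}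
    (h : IsMatchingList ((a, b) :: l) X Y) :
    ∃ X' Y', a ∉ X' ∧ b ∉ Y' ∧ X = insert a X' ∧ Y = insert b Y' ∧
      (∀ e ∈ l, e.1 ≠ a ∧ e.2 ≠ b) ∧ IsMatchingList l X' Y' := by
  obtain ⟨hm, h1, h2⟩ := h
  rw [List.map_cons, List.nodup_cons] at h1 h2
  have hab := hm (a, b) (by simp)
  have hne : ∀ e ∈ l, e.1 ≠ a ∧ e.2 ≠ b := fun e he =>
    ⟨fun h => h1.1 (List.mem_map.2 ⟨e, he, h⟩),
      fun h => h2.1 (List.mem_map.2 ⟨e, he, h⟩)⟩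
  refine ⟨X.erase a, Y.erase b, by simp, by simp, (Finset.insert_erase hab.1).symm,
    (Finset.insert_erase hab.2).symm, hne, fun e he => ?_, h1.2, h2.2⟩
  have := hm e (by simp [he])
  simp [this, hne e he]

/-- Removing an element from a set of size `s + u`: the ratios of binomial coefficients. -/
lemma choose_ratio (s u : ℕ) :
    (((s + u + 1).choose (s + 1) : ℕ) : ℝ) * (((s + 1 : ℕ) : ℝ) / ((s + u + 1 : ℕ) : ℝ)) =
        (s + u).choose s ∧
      (((s + u + 1).choose (s + 1) : ℕ) : ℝ) * (1 - ((s + 1 : ℕ) : ℝ) / ((s + u + 1 : ℕ) : ℝ)) =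
        (s + u).choose (s + 1) := by
  have h1 : (((s + u + 1).choose (s + 1) : ℕ) : ℝ) * (((s + 1 : ℕ) : ℝ) / ((s + u + 1 : ℕ) : ℝ)) =
        (s + u).choose s := by
    have := Nat.add_one_mul_choose_eq (s + u) s
    have h' : (((s + u + 1 : ℕ) : ℝ)) * ((s + u).choose s : ℝ) =
      ((s + u + 1).choose (s + 1) : ℝ) * ((s + 1 : ℕ) : ℝ) := by exact_mod_cast this
    rw [mul_div_assoc', ← h', mul_div_cancel_left₀]
    positivity
  refine ⟨h1, ?_⟩
  rw [mul_sub, h1, Nat.choose_succ_succ]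
  push_cast
  ring

/-- If a proportion of at least `c` is selected on both sides, a random pair is separated with
probability at most `1 - c ^ 2`. -/
lemma separation_prob_le {c x y : ℝ} (hc : 0 ≤ c) (hcx : c ≤ x) (hcy : c ≤ y) (hx : x ≤ 1)
    (hy : y ≤ 1) : x * (1 - y) + (1 - x) * y ≤ 1 - c ^ 2 := by
  nlinarith [mul_le_mul hcx hcy hc (hc.trans hcx), mul_nonneg (sub_nonneg.2 hx) (sub_nonneg.2 hy)]

/-- If both terms of the pair recursion obey a bound with factor `B`, their difference obeys the
bound with factor `(1 - c ^ 2) * B`. -/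
lemma abs_sub_le_of_pair_bounds {c N B P Q : ℝ} {s u t v : ℕ} (hc : 0 < c)
    (hB : 0 ≤ B) (hs : c * N ≤ (s + 1 : ℕ)) (ht : c * N ≤ (t + 1 : ℕ))
    (hsu : ((s + u + 1 : ℕ) : ℝ) ≤ N) (htv : ((t + v + 1 : ℕ) : ℝ) ≤ N)
    (hP : |P| ≤ B * ((s + u).choose s * (t + v).choose (t + 1)))
    (hQ : |Q| ≤ B * ((s + u).choose (s + 1) * (t + v).choose t)) :
    |P - Q| ≤ (1 - c ^ 2) * B *
      ((s + u + 1).choose (s + 1) * (t + v + 1).choose (t + 1)) := by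
  obtain ⟨h1, h2⟩ := choose_ratio s u
  obtain ⟨h3, h4⟩ := choose_ratio t v
  have key : ∀ k w : ℕ, c * N ≤ (k + 1 : ℕ) → ((k + w + 1 : ℕ) : ℝ) ≤ N →
      c ≤ ((k + 1 : ℕ) : ℝ) / ((k + w + 1 : ℕ) : ℝ) ∧
      ((k + 1 : ℕ) : ℝ) / ((k + w + 1 : ℕ) : ℝ) ≤ 1 := by
    intro k w hk hkw
    have hpos : (0 : ℝ) < ((k + w + 1 : ℕ) : ℝ) := by positivity
    constructor
    · rw [le_div_iff₀ hpos]
      exact (mul_le_mul_of_nonneg_left hkw hc.le).trans hk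
    · rw [div_le_one hpos]
      exact_mod_cast (by omega : k + 1 ≤ k + w + 1)
  obtain ⟨hx1, hx2⟩ := key s u hs hsu
  obtain ⟨hy1, hy2⟩ := key t v ht htv
  rw [← h1, ← h4] at hP
  rw [← h2, ← h3] at hQ
  set x := ((s + 1 : ℕ) : ℝ) / ((s + u + 1 : ℕ) : ℝ)
  set y := ((t + 1 : ℕ) : ℝ) / ((t + v + 1 : ℕ) : ℝ)
  set D₁ : ℝ := (((s + u + 1).choose (s + 1) : ℕ) : ℝ)
  set D₂ : ℝ := (((t + v + 1).choose (t + 1) : ℕ) : ℝ)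
  have hD : 0 ≤ B * (D₁ * D₂) := by positivity
  calc |P - Q| ≤ |P| + |Q| := abs_sub _ _
    _ ≤ B * (D₁ * x * (D₂ * (1 - y))) + B * (D₁ * (1 - x) * (D₂ * y)) := add_le_add hP hQ
    _ = (x * (1 - y) + (1 - x) * y) * (B * (D₁ * D₂)) := by ring
    _ ≤ (1 - c ^ 2) * (B * (D₁ * D₂)) :=
      mul_le_mul_of_nonneg_right (separation_prob_le hc.le hx1 hy1 hx2 hy2) hD
    _ = _ := by ring

/-- Exponential decay of `pairSum` in the number of pairs. -/
lemma abs_pairSum_le_pow {c N : ℝ} (hc : 0 < c) (hc1 : c ≤ 1) (hN : 0 < N) (m : ℕ) :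
    ∀ (l : List (ι × ι)) (X Y : Finset ι) (s u t v : ℕ), IsMatchingList l X Y →
      X.card = s + u → Y.card = t + v → m ≤ l.length → (X.card : ℝ) ≤ N → (Y.card : ℝ) ≤ N →
      c * N + m ≤ s → c * N + m ≤ u → c * N + m ≤ t → c * N + m ≤ v →
      |pairSum l X Y s t| ≤ (1 - c ^ 2) ^ m * (X.card.choose s * Y.card.choose t) := by
  have hcN : 0 < c * N := mul_pos hc hN
  have hc2 : 0 ≤ 1 - c ^ 2 := by nlinarith
  induction m with
  | zero =>
    intro l X Y s u t v _ _ _ _ _ _ _ _ _ _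
    simpa using abs_pairSum_le l X Y s t
  | succ m ih =>
    intro l X Y s u t v hl hX hY hm hXN hYN hs hu ht hv
    obtain _ | ⟨⟨a, b⟩, l⟩ := l
    · simp at hm
    push_cast at hs hu ht hv
    have pos : ∀ k : ℕ, c * N + (m + 1) ≤ k → ∃ k', k = k' + 1 := fun k hk =>
      Nat.exists_eq_succ_of_ne_zero fun h => by
        rw [h] at hk; push_cast at hk; linarith [(Nat.cast_nonneg m : (0 : ℝ) ≤ m)]
    obtain ⟨s, rfl⟩ := pos s hs
    obtain ⟨u, rfl⟩ := pos u hu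
    obtain ⟨t, rfl⟩ := pos t ht
    obtain ⟨v, rfl⟩ := pos v hv
    obtain ⟨X, Y, ha, hb, rfl, rfl, hne, hl'⟩ := hl.exists_insert
    rw [Finset.card_insert_of_notMem ha] at hX hXN ⊢
    rw [Finset.card_insert_of_notMem hb] at hY hYN ⊢
    have hX' : X.card = s + (u + 1) := by omega
    have hY' : Y.card = t + (v + 1) := by omega
    rw [hX'] at hXN ⊢
    rw [hY'] at hYN ⊢
    push_cast at hs hu ht hv hXN hYN
    have hm0 : (0 : ℝ) ≤ m := Nat.cast_nonneg m
    rw [pairSum_cons ha hb hne, pow_succ']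
    refine abs_sub_le_of_pair_bounds (N := N) hc (pow_nonneg hc2 m) ?_ ?_ ?_ ?_ ?_ ?_
    · push_cast; linarith
    · push_cast; linarith
    · push_cast; linarith
    · push_cast; linarith
    · rw [← hX', ← hY']
      refine ih l X Y s (u + 1) (t + 1) v hl' hX' (by omega) (by simpa using hm) ?_ ?_ ?_ ?_ ?_ ?_
      · rw [hX']; push_cast; linarith
      · rw [hY']; push_cast; linarith
      all_goals push_cast; linarith
    · rw [← hX', ← hY']
      refine ih l X Y (s + 1) u t (v + 1) hl' (by omega) hY' (by simpa using hm) ?_ ?_ ?_ ?_ ?_ ?_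
      · rw [hX']; push_cast; linarith
      · rw [hY']; push_cast; linarith
      all_goals push_cast; linarith

lemma abs_ratio_sub_le {K p s s' : ℝ} (hK : 0 < K) (hp : K ≤ p) (h0 : 0 ≤ s') (hs : s' ≤ s)
    (hs1 : s ≤ s' + 1) (hsp : s' ≤ p) :
    |s' / p - s / (p + 1)| ≤ 1 / K := by
  have hp0 : 0 < p := hK.trans_le hp
  rw [div_sub_div _ _ hp0.ne' (by linarith), abs_div, abs_of_pos (by positivity : 0 < p * (p + 1)),
    div_le_div_iff₀ (by positivity) hK]
  have : |s' * (p + 1) - p * s| ≤ p := by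
    rw [abs_le]; constructor <;> nlinarith
  nlinarith

/-- A bound for `pairSum` in terms of the difference of the densities on the two sides. -/
lemma abs_pairSum_le_density {c N : ℝ} (hc : 0 < c) (hc1 : c ≤ 1) (hN : 0 < N) (j : ℕ) :
    ∀ (l : List (ι × ι)) (X Y : Finset ι) (s u t v : ℕ), IsMatchingList l X Y →
      X.card = s + u → Y.card = t + v → l.length = j + 1 → (X.card : ℝ) ≤ N → (Y.card : ℝ) ≤ N →
      c * N + j ≤ s → c * N + j ≤ u → c * N + j ≤ t → c * N + j ≤ v →
      |pairSum l X Y s t| ≤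
        (1 - c ^ 2) ^ j * (|(s : ℝ) / X.card - t / Y.card| + j * (2 / (c * N))) *
          (X.card.choose s * Y.card.choose t) := by
  have hcN : 0 < c * N := mul_pos hc hN
  have hc2 : 0 ≤ 1 - c ^ 2 := by nlinarith
  induction j with
  | zero =>
    intro l X Y s u t v hl hX hY hlen hXN hYN hs hu ht hv
    obtain _ | ⟨⟨a, b⟩, l⟩ := l
    · simp at hlen
    obtain rfl : l = [] := by simpa using hlen
    have pos : ∀ k : ℕ, c * N + (0 : ℕ) ≤ k → ∃ k', k = k' + 1 := fun k hk =>
      Nat.exists_eq_succ_of_ne_zero fun h => by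
        rw [h] at hk; push_cast at hk; linarith
    obtain ⟨s, rfl⟩ := pos s hs
    obtain ⟨t, rfl⟩ := pos t ht
    obtain ⟨X, Y, ha, hb, rfl, rfl, hne, hl'⟩ := hl.exists_insert
    rw [pairSum_cons ha hb hne, pairSum_nil, pairSum_nil]
    rw [Finset.card_insert_of_notMem ha] at hX ⊢
    rw [Finset.card_insert_of_notMem hb] at hY ⊢
    obtain ⟨h1, h2⟩ := choose_ratio s u
    obtain ⟨h3, h4⟩ := choose_ratio t v
    have hX' : X.card = s + u := by omega
    have hY' : Y.card = t + v := by omega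
    rw [hX', hY', ← h1, ← h2, ← h3, ← h4]
    set x := ((s + 1 : ℕ) : ℝ) / ((s + u + 1 : ℕ) : ℝ)
    set y := ((t + 1 : ℕ) : ℝ) / ((t + v + 1 : ℕ) : ℝ)
    set D₁ : ℝ := (((s + u + 1).choose (s + 1) : ℕ) : ℝ)
    set D₂ : ℝ := (((t + v + 1).choose (t + 1) : ℕ) : ℝ)
    have e : D₁ * x * (D₂ * (1 - y)) - D₁ * (1 - x) * (D₂ * y) = (x - y) * (D₁ * D₂) := by ring
    have hD : 0 ≤ D₁ * D₂ := by positivity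
    rw [e, abs_mul, abs_of_nonneg hD]
    simp
  | succ j ih =>
    intro l X Y s u t v hl hX hY hlen hXN hYN hs hu ht hv
    obtain _ | ⟨⟨a, b⟩, l⟩ := l
    · simp at hlen
    push_cast at hs hu ht hv
    have pos : ∀ k : ℕ, c * N + (j + 1) ≤ k → ∃ k', k = k' + 1 := fun k hk =>
      Nat.exists_eq_succ_of_ne_zero fun h => by
        rw [h] at hk; push_cast at hk; linarith [(Nat.cast_nonneg j : (0 : ℝ) ≤ j)]
    obtain ⟨s, rfl⟩ := pos s hs
    obtain ⟨u, rfl⟩ := pos u hu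
    obtain ⟨t, rfl⟩ := pos t ht
    obtain ⟨v, rfl⟩ := pos v hv
    obtain ⟨X, Y, ha, hb, rfl, rfl, hne, hl'⟩ := hl.exists_insert
    rw [Finset.card_insert_of_notMem ha] at hX hXN ⊢
    rw [Finset.card_insert_of_notMem hb] at hY hYN ⊢
    have hX' : X.card = s + (u + 1) := by omega
    have hY' : Y.card = t + (v + 1) := by omega
    have hXc : (X.card : ℝ) = s + u + 1 := by rw [hX']; push_cast; ring
    have hYc : (Y.card : ℝ) = t + v + 1 := by rw [hY']; push_cast; ring
    push_cast at hs hu ht hv hXN hYN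
    have hj0 : (0 : ℝ) ≤ j := Nat.cast_nonneg j
    have hs0 : (0 : ℝ) ≤ s := Nat.cast_nonneg s
    have ht0 : (0 : ℝ) ≤ t := Nat.cast_nonneg t
    have hu0 : (0 : ℝ) ≤ u := Nat.cast_nonneg u
    have hv0 : (0 : ℝ) ≤ v := Nat.cast_nonneg v
    have hlen' : l.length = j + 1 := by simpa using hlen
    have ihP := ih l X Y s (u + 1) (t + 1) v hl' hX' (by omega) hlen'
      (by linarith) (by linarith) (by linarith) (by push_cast; linarith)
      (by push_cast; linarith) (by linarith)
    have ihQ := ih l X Y (s + 1) u t (v + 1) hl' (by omega) hY' hlen'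
      (by linarith) (by linarith) (by push_cast; linarith) (by linarith)
      (by linarith) (by push_cast; linarith)
    have hx := fun (k : ℝ) (h0 : 0 ≤ k) (h1 : k ≤ s + 1) (h2 : (s : ℝ) + 1 ≤ k + 1)
        (h3 : k ≤ X.card) =>
      abs_ratio_sub_le (K := c * N) (p := X.card) (s := s + 1) (s' := k) hcN
        (by linarith) h0 h1 h2 h3
    have hy := fun (k : ℝ) (h0 : 0 ≤ k) (h1 : k ≤ t + 1) (h2 : (t : ℝ) + 1 ≤ k + 1)
        (h3 : k ≤ Y.card) =>
      abs_ratio_sub_le (K := c * N) (p := Y.card) (s := t + 1) (s' := k) hcN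
        (by linarith) h0 h1 h2 h3
    have hx1 := hx s (by linarith) (by linarith) (by linarith) (by linarith)
    have hx2 := hx (s + 1) (by linarith) (by linarith) (by linarith) (by linarith)
    have hy1 := hy t (by linarith) (by linarith) (by linarith) (by linarith)
    have hy2 := hy (t + 1) (by linarith) (by linarith) (by linarith) (by linarith)
    have tri : ∀ x y x₀ y₀ : ℝ, |x - x₀| ≤ 1 / (c * N) → |y - y₀| ≤ 1 / (c * N) →
        |x - y| + j * (2 / (c * N)) ≤ |x₀ - y₀| + ((j + 1 : ℕ) : ℝ) * (2 / (c * N)) := by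
      intro x y x₀ y₀ h1 h2
      have e : (2 : ℝ) / (c * N) = 1 / (c * N) + 1 / (c * N) := by ring
      have h3 : |x - y| ≤ |x₀ - y₀| + |x - x₀| + |y - y₀| := by
        have := abs_sub_le x x₀ y
        have h' := abs_sub_le x₀ y₀ y
        rw [abs_sub_comm y₀ y] at h'
        linarith
      push_cast
      linarith [e]
    push_cast at ihP ihQ
    rw [pairSum_cons ha hb hne, pow_succ', mul_assoc (1 - c ^ 2), hX', hY']
    refine abs_sub_le_of_pair_bounds (N := N) hc (by positivity) ?_ ?_ ?_ ?_ ?_ ?_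
    · push_cast; linarith
    · push_cast; linarith
    · push_cast; linarith
    · push_cast; linarith
    · rw [← hX', ← hY']
      refine ihP.trans ?_
      refine mul_le_mul_of_nonneg_right (mul_le_mul_of_nonneg_left ?_ (by positivity))
        (by positivity)
      simpa using tri _ _ _ _ hx1 hy2
    · rw [← hX', ← hY']
      refine ihQ.trans ?_
      refine mul_le_mul_of_nonneg_right (mul_le_mul_of_nonneg_left ?_ (by positivity))
        (by positivity)
      simpa using tri _ _ _ _ hx2 hy1

lemma nat_mul_pow_le {y : ℝ} (hy : 0 < y) (hy1 : y ≤ 1) (j : ℕ) : j * (1 - y) ^ j ≤ 1 / y := by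
  have h1 : (1 - y) ^ j * (1 + y) ^ j ≤ 1 := by
    rw [← mul_pow]
    exact pow_le_one₀ (by nlinarith) (by nlinarith)
  have h2 : 1 + j * y ≤ (1 + y) ^ j := one_add_mul_le_pow (by linarith) j
  have h3 : 0 ≤ (1 - y) ^ j := pow_nonneg (by linarith) j
  rw [le_div_iff₀ hy]
  nlinarith [mul_le_mul_of_nonneg_left h2 h3]

end PairSum

section SwapInvariant

variable {ι : Type*}

/-- The pairs in `l` are disjoint two-element sets. -/
structure IsPairing (l : List (ι × ι)) : Prop where
  ne : ∀ e ∈ l, e.1 ≠ e.2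
  disj : l.Pairwise fun e f => e.1 ≠ f.1 ∧ e.1 ≠ f.2 ∧ e.2 ≠ f.1 ∧ e.2 ≠ f.2

lemma IsPairing.nodup_fst {l : List (ι × ι)} (h : IsPairing l) : (l.map Prod.fst).Nodup :=
  List.pairwise_map.2 (h.disj.imp fun h => h.1)

lemma IsPairing.nodup_snd {l : List (ι × ι)} (h : IsPairing l) : (l.map Prod.snd).Nodup :=
  List.pairwise_map.2 (h.disj.imp fun h => h.2.2.2)

lemma IsPairing.length_le [Fintype ι] {l : List (ι × ι)} (h : IsPairing l) :
    l.length ≤ Fintype.card ι := by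
  simpa using h.nodup_fst.length_le_card

lemma IsPairing.cons {c d : ι} {l : List (ι × ι)} (h : IsPairing l) (hcd : c ≠ d)
    (hl : ∀ e ∈ l, e.1 ≠ c ∧ e.1 ≠ d ∧ e.2 ≠ c ∧ e.2 ≠ d) : IsPairing ((c, d) :: l) := by
  refine ⟨?_, List.pairwise_cons.2 ⟨fun e he => ?_, h.disj⟩⟩
  · rintro e he
    rcases List.mem_cons.1 he with rfl | he
    · exact hcd
    · exact h.ne e he
  · obtain ⟨h1, h2, h3, h4⟩ := hl e he
    exact ⟨h1.symm, h3.symm, h2.symm, h4.symm⟩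

lemma IsPairing.tail {e : ι × ι} {l : List (ι × ι)} (h : IsPairing (e :: l)) : IsPairing l :=
  ⟨fun f hf => h.ne f (List.mem_cons_of_mem _ hf), (List.pairwise_cons.1 h.disj).2⟩

variable [DecidableEq ι]

/-- The image of a set under the transposition of `a` and `b`. -/
def swapSet (a b : ι) (S : Finset ι) : Finset ι := S.map (Equiv.swap a b).toEmbedding

lemma mem_swapSet {a b x : ι} {S : Finset ι} : x ∈ swapSet a b S ↔ Equiv.swap a b x ∈ S := by
  simp [swapSet, Finset.mem_map_equiv]

lemma card_swapSet (a b : ι) (S : Finset ι) : (swapSet a b S).card = S.card := by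
  simp [swapSet]

lemma swapSet_swapSet (a b : ι) (S : Finset ι) : swapSet a b (swapSet a b S) = S := by
  ext x; simp [mem_swapSet]

lemma swapSet_comm (a b : ι) (S : Finset ι) : swapSet a b S = swapSet b a S := by
  rw [swapSet, swapSet, Equiv.swap_comm]

lemma mem_swapSet_of_ne {a b x : ι} {S : Finset ι} (ha : x ≠ a) (hb : x ≠ b) :
    x ∈ swapSet a b S ↔ x ∈ S := by
  rw [mem_swapSet, Equiv.swap_apply_of_ne_of_ne ha hb]

lemma left_mem_swapSet {a b : ι} {S : Finset ι} : a ∈ swapSet a b S ↔ b ∈ S := by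
  simp [mem_swapSet]

lemma right_mem_swapSet {a b : ι} {S : Finset ι} : b ∈ swapSet a b S ↔ a ∈ S := by
  simp [mem_swapSet]

lemma swapSet_eq_self {a b : ι} {S : Finset ι} (h : a ∈ S ↔ b ∈ S) : swapSet a b S = S := by
  ext x
  by_cases ha : x = a
  · rw [ha, left_mem_swapSet, h]
  by_cases hb : x = b
  · rw [hb, right_mem_swapSet, h]
  exact mem_swapSet_of_ne ha hb

lemma swapSet_swapSet_comm {a b c d : ι} (hac : a ≠ c) (had : a ≠ d) (hbc : b ≠ c) (hbd : b ≠ d)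
    (S : Finset ι) : swapSet a b (swapSet c d S) = swapSet c d (swapSet a b S) := by
  ext x
  simp only [mem_swapSet, Equiv.swap_apply_def]
  grind

lemma card_swapSet_sdiff_lt {a b : ι} {W X : Finset ι} (ha : a ∈ X) (hb : b ∉ X) (haW : a ∉ W)
    (hbW : b ∈ W) : (swapSet a b W \ X).card < (W \ X).card := by
  refine Finset.card_lt_card (Finset.ssubset_iff_of_subset ?_ |>.2
    ⟨b, by simp [hb, hbW], by simp [right_mem_swapSet, haW]⟩)
  intro x hx
  rw [Finset.mem_sdiff] at hx ⊢
  have hxa : x ≠ a := fun h => hx.2 (h ▸ ha)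
  have hxb : x ≠ b := fun h => haW (right_mem_swapSet.1 (h ▸ hx.1))
  exact ⟨(mem_swapSet_of_ne hxa hxb).1 hx.1, hx.2⟩

lemma IsPairing.pairProd_swapSet {l : List (ι × ι)} (h : IsPairing l) {e : ι × ι} (he : e ∈ l)
    (W : Finset ι) :
    pairProd l (swapSet e.1 e.2 W) (swapSet e.1 e.2 W) = -pairProd l W W := by
  induction l with
  | nil => simp at he
  | cons f l ih =>
    have hf := (List.pairwise_cons.1 h.disj).1
    rw [pairProd_cons, pairProd_cons]
    rcases List.mem_cons.1 he with rfl | he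
    · rw [pairProd_congr (W' := W) (Z' := W)]
      · simp only [left_mem_swapSet, right_mem_swapSet]
        ring
      · intro g hg
        obtain ⟨h1, h2, h3, h4⟩ := hf g hg
        exact ⟨mem_swapSet_of_ne h1.symm h3.symm, mem_swapSet_of_ne h2.symm h4.symm⟩
    · obtain ⟨h1, h2, h3, h4⟩ := hf e he
      rw [ih h.tail he]
      simp only [mem_swapSet_of_ne h1 h2, mem_swapSet_of_ne h3 h4]
      ring

/-- `F` changes sign under the transposition of each pair in `l`. -/
def IsSwapAntisymm (F : Finset ι → ℝ) (l : List (ι × ι)) : Prop :=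
  ∀ e ∈ l, ∀ S, F (swapSet e.1 e.2 S) = -F S

lemma IsSwapAntisymm.eq_zero {F : Finset ι → ℝ} {l : List (ι × ι)} (h : IsSwapAntisymm F l)
    {e : ι × ι} (he : e ∈ l) {S : Finset ι} (hS : e.1 ∈ S ↔ e.2 ∈ S) : F S = 0 := by
  have := h e he S
  rw [swapSet_eq_self hS] at this
  linarith

/-- Among the functions in a nonzero swap-invariant space, one that is antisymmetric under a
maximal number of disjoint transpositions is invariant under all transpositions disjoint from
them. -/
lemma exists_antisymm_maximal [Fintype ι] (E : Submodule ℝ (Finset ι → ℝ))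
    (hswap : ∀ F ∈ E, ∀ a b, (fun S => F (swapSet a b S)) ∈ E) (hE : ∃ F ∈ E, F ≠ 0) :
    ∃ F ∈ E, F ≠ 0 ∧ ∃ l, IsPairing l ∧ IsSwapAntisymm F l ∧
      ∀ c d, (∀ e ∈ l, e.1 ≠ c ∧ e.1 ≠ d ∧ e.2 ≠ c ∧ e.2 ≠ d) → ∀ S, F (swapSet c d S) = F S := by
  by_contra! hcon
  have ext : ∀ j : ℕ, ∃ F ∈ E, F ≠ 0 ∧ ∃ l, IsPairing l ∧ IsSwapAntisymm F l ∧ l.length = j := by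
    intro j
    induction j with
    | zero =>
      obtain ⟨F, hF, hF0⟩ := hE
      exact ⟨F, hF, hF0, [], ⟨by simp, by simp⟩, by simp [IsSwapAntisymm], rfl⟩
    | succ j ih =>
      obtain ⟨F, hF, hF0, l, hl, hFl, hlen⟩ := ih
      obtain ⟨c, d, hcd, S, hS⟩ := hcon F hF hF0 l hl hFl
      have hne : c ≠ d := by
        rintro rfl
        exact hS (by rw [swapSet_eq_self Iff.rfl])
      refine ⟨_, E.sub_mem hF (hswap F hF c d), fun h => hS ?_, (c, d) :: l, hl.cons hne hcd,
        ?_, by simp [hlen]⟩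
      · have := congrFun h S
        simp only [Pi.sub_apply, Pi.zero_apply] at this
        linarith
      · intro e he S
        simp only [Pi.sub_apply]
        rcases List.mem_cons.1 he with rfl | he
        · rw [swapSet_swapSet]; ring
        · obtain ⟨h1, h2, h3, h4⟩ := hcd e he
          rw [← swapSet_swapSet_comm h1 h2 h3 h4, hFl e he, hFl e he]
          ring
  obtain ⟨F, -, -, l, hl, -, hlen⟩ := ext (Fintype.card ι + 1)
  have := hl.length_le
  omega

/-- A function on the `r`-subsets that is antisymmetric under the transpositions of `l` and
invariant under the disjoint ones is a multiple of `pairProd l`. -/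
lemma eq_mul_pairProd [Fintype ι] {F : Finset ι → ℝ} {l : List (ι × ι)} {X : Finset ι}
    (hl : IsPairing l) (hX : IsMatchingList l X Xᶜ) (hF : IsSwapAntisymm F l)
    (hinv : ∀ c d, (∀ e ∈ l, e.1 ≠ c ∧ e.1 ≠ d ∧ e.2 ≠ c ∧ e.2 ≠ d) →
      ∀ S, F (swapSet c d S) = F S) (W : Finset ι) (hW : W.card = X.card) :
    F W = F X * pairProd l W W := by
  induction hk : (W \ X).card using Nat.strong_induction_on generalizing W with
  | _ k ih =>
    have hmem : ∀ e ∈ l, e.1 ∈ X ∧ e.2 ∉ X := fun e he => by simpa using hX.mem e he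
    by_cases h1 : ∃ e ∈ l, (e.1 ∈ W ↔ e.2 ∈ W)
    · obtain ⟨e, he, heW⟩ := h1
      have : pairProd l W W = 0 := by
        refine List.prod_eq_zero (List.mem_map.2 ⟨e, he, ?_⟩)
        simp [heW]
      rw [this, hF.eq_zero he heW, mul_zero]
    push Not at h1
    by_cases h2 : ∃ e ∈ l, e.1 ∉ W
    · obtain ⟨e, he, heW⟩ := h2
      have heW' : e.2 ∈ W := by
        rcases h1 e he with h | h
        · exact absurd h.1 heW
        · exact h.2
      have := ih _ (hk ▸ card_swapSet_sdiff_lt (hmem e he).1 (hmem e he).2 heW heW')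
        (swapSet e.1 e.2 W) (by rw [card_swapSet, hW]) rfl
      rw [hF e he, hl.pairProd_swapSet he] at this
      linarith
    push Not at h2
    have h3 : ∀ e ∈ l, e.2 ∉ W := fun e he => by
      rcases h1 e he with h | h
      · exact h.2
      · exact absurd (h2 e he) h.1
    have hprod : pairProd l W W = 1 := by
      refine List.prod_eq_one fun x hx => ?_
      obtain ⟨e, he, rfl⟩ := List.mem_map.1 hx
      simp [h2 e he, h3 e he]
    by_cases hWX : W = X
    · rw [hprod, mul_one, hWX]
    obtain ⟨c, hc, hcX⟩ : ∃ c ∈ W, c ∉ X := by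
      by_contra! h
      exact hWX (Finset.eq_of_subset_of_card_le h hW.ge)
    obtain ⟨d, hd, hdW⟩ : ∃ d ∈ X, d ∉ W := by
      by_contra! h
      exact hWX (Finset.eq_of_subset_of_card_le h hW.le).symm
    have hdc : ∀ e ∈ l, e.1 ≠ d ∧ e.1 ≠ c ∧ e.2 ≠ d ∧ e.2 ≠ c := fun e he =>
      ⟨fun h => hdW (h ▸ h2 e he), fun h => hcX (h ▸ (hmem e he).1),
        fun h => (hmem e he).2 (h ▸ hd), fun h => h3 e he (h ▸ hc)⟩
    have := ih _ (hk ▸ card_swapSet_sdiff_lt hd hcX hdW hc) (swapSet d c W)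
      (by rw [card_swapSet, hW]) rfl
    rw [hinv d c hdc] at this
    rw [this, pairProd_congr]
    intro e he
    obtain ⟨g1, g2, g3, g4⟩ := hdc e he
    exact ⟨mem_swapSet_of_ne g1 g2, mem_swapSet_of_ne g3 g4⟩

/-- A nonzero swap-invariant space of functions on the `r`-subsets contains a multiple of
`pairProd l` for some list `l` of disjoint pairs. -/
lemma exists_mem_eq_mul_pairProd [Fintype ι] (E : Submodule ℝ (Finset ι → ℝ)) (r : ℕ)
    (hswap : ∀ F ∈ E, ∀ a b, (fun S => F (swapSet a b S)) ∈ E)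
    (hsupp : ∀ F ∈ E, ∀ S : Finset ι, S.card ≠ r → F S = 0) (hE : ∃ F ∈ E, F ≠ 0) :
    ∃ F ∈ E, ∃ X : Finset ι, ∃ l, X.card = r ∧ F X ≠ 0 ∧ IsMatchingList l X Xᶜ ∧
      ∀ W : Finset ι, W.card = r → F W = F X * pairProd l W W := by
  obtain ⟨F, hF, hF0, l, hl, hFl, hinv⟩ := exists_antisymm_maximal E hswap hE
  obtain ⟨X, hX⟩ := Function.ne_iff.1 hF0
  have hXr : X.card = r := by
    by_contra h
    exact hX (hsupp F hF X h)
  set o : ι × ι → ι × ι := fun e => if e.1 ∈ X then e else (e.2, e.1) with ho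
  have ho' : ∀ e, o e = e ∨ o e = (e.2, e.1) := fun e => by
    simp only [ho]; split_ifs <;> simp
  have hsep : ∀ e ∈ l, ¬(e.1 ∈ X ↔ e.2 ∈ X) := fun e he h => hX (hFl.eq_zero he h)
  have hl' : IsPairing (l.map o) := by
    refine ⟨?_, List.pairwise_map.2 (hl.disj.imp ?_)⟩
    · intro e he
      obtain ⟨f, hf, rfl⟩ := List.mem_map.1 he
      rcases ho' f with h | h <;> rw [h]
      · exact hl.ne f hf
      · exact (hl.ne f hf).symm
    · rintro e f ⟨h1, h2, h3, h4⟩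
      rcases ho' e with h | h <;> rcases ho' f with h' | h' <;> rw [h, h'] <;>
        simp [h1, h2, h3, h4]
  have hFl' : IsSwapAntisymm F (l.map o) := by
    intro e he S
    obtain ⟨f, hf, rfl⟩ := List.mem_map.1 he
    rcases ho' f with h | h <;> rw [h]
    · exact hFl f hf S
    · rw [swapSet_comm]; exact hFl f hf S
  have hmatch : IsMatchingList (l.map o) X Xᶜ := by
    refine ⟨?_, hl'.nodup_fst, hl'.nodup_snd⟩
    intro e he
    obtain ⟨f, hf, rfl⟩ := List.mem_map.1 he
    have := hsep f hf
    rw [Finset.mem_compl]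
    simp only [ho]
    split_ifs with h <;> tauto
  refine ⟨F, hF, X, l.map o, hXr, hX, hmatch, fun W hW => ?_⟩
  refine eq_mul_pairProd hl' hmatch hFl' (fun c d hcd => hinv c d fun e he => ?_) W
    (hW.trans hXr.symm)
  have := hcd (o e) (List.mem_map_of_mem he)
  rcases ho' e with h | h <;> rw [h] at this
  · exact this
  · exact ⟨this.2.2.1, this.2.2.2, this.1, this.2.1⟩

end SwapInvariant

section Spectrum

variable {V : Type*} [Fintype V]

lemma sum_neighborFinset_eq_of_regular (G : SimpleGraph V) [DecidableRel G.Adj] {d : ℕ}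
    (hd : G.IsRegularOfDegree d) (x : V → ℝ) :
    ∑ v, ∑ w ∈ G.neighborFinset v, x w = d * ∑ v, x v := by
  rw [Finset.sum_comm' (t' := Finset.univ) (s' := fun w => G.neighborFinset w)
    (by simp [G.adj_comm]), Finset.mul_sum]
  refine Finset.sum_congr rfl fun w _ => ?_
  rw [Finset.sum_const, G.card_neighborFinset_eq_degree, hd w, nsmul_eq_mul]

variable [DecidableEq V]

/-- For a regular graph, `secondEigenvalue` is controlled by the eigenvectors with zero sum. -/
lemma secondEigenvalue_le (G : SimpleGraph V) [DecidableRel G.Adj] {d : ℕ}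
    (hd : G.IsRegularOfDegree d) {B : ℝ} (hB : 0 ≤ B)
    (h : ∀ (μ : ℝ) (x : V → ℝ), x ≠ 0 → ∑ v, x v = 0 →
      (∀ v, ∑ w ∈ G.neighborFinset v, x w = μ * x v) → |μ| ≤ B) :
    secondEigenvalue G ≤ B := by
  refine Real.iSup_le (fun k => ?_) hB
  obtain ⟨k, hk⟩ := k
  set hA := G.isHermitian_adjMatrix ℝ
  set φ : Fin (Fintype.card V) ≃ V := Fintype.equivOfCardEq (Fintype.card_fin _)
  have heig : ∀ i, hA.eigenvalues (φ i) = graphSpectrum G i := fun i => by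
    change hA.eigenvalues₀ (φ.symm (φ i)) = _
    rw [Equiv.symm_apply_apply]
    rfl
  set x : Fin (Fintype.card V) → V → ℝ := fun i => hA.eigenvectorBasis (φ i) with hx
  have hxeq : ∀ i v, ∑ w ∈ G.neighborFinset v, x i w = graphSpectrum G i * x i v := fun i v => by
    have := congrFun (hA.mulVec_eigenvectorBasis (φ i)) v
    rw [SimpleGraph.adjMatrix_mulVec_apply, heig] at this
    simpa using this
  have hli : ∀ (i j : Fin (Fintype.card V)) (a b : ℝ), i ≠ j →
      (∀ v, a * x i v + b * x j v = 0) → a = 0 ∧ b = 0 := by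
    intro i j a b hij hab
    have hinj : Function.Injective ![φ i, φ j] := by
      intro p q hpq
      fin_cases p <;> fin_cases q <;> simp_all
    have hl := hA.eigenvectorBasis.orthonormal.linearIndependent.comp _ hinj
    have e : (hA.eigenvectorBasis : V → EuclideanSpace ℝ V) ∘ ![φ i, φ j] =
        ![hA.eigenvectorBasis (φ i), hA.eigenvectorBasis (φ j)] := by
      funext p
      fin_cases p <;> rfl
    rw [e] at hl
    refine LinearIndependent.pair_iff.1 hl a b ?_
    ext v
    simpa [hx] using hab v
  let z : Fin (Fintype.card V) := ⟨0, k.pos⟩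
  have hzk : z ≠ k := fun h' => by rw [← h'] at hk; simp [z] at hk
  have hx0 : ∀ i, x i ≠ 0 := fun i h0 => by
    have hij : ∃ j, i ≠ j := by
      by_cases hi : i = z
      · exact ⟨k, hi ▸ hzk⟩
      · exact ⟨z, hi⟩
    obtain ⟨j, hij⟩ := hij
    have := hli i j 1 0 hij (fun v => by simp [h0])
    exact one_ne_zero this.1
  have hsum : ∀ i, ∑ v, x i v = 0 ∨ graphSpectrum G i = d := fun i => by
    have h1 := sum_neighborFinset_eq_of_regular G hd (x i)
    simp_rw [hxeq i, ← Finset.mul_sum] at h1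
    by_cases h0 : ∑ v, x i v = 0
    · exact Or.inl h0
    · exact Or.inr (mul_right_cancel₀ h0 h1)
  have hmono : graphSpectrum G k ≤ graphSpectrum G z :=
    hA.eigenvalues₀_antitone (Fin.mk_le_of_le_val (Nat.zero_le _))
  by_cases hk0 : ∑ v, x k v = 0
  · exact h _ (x k) (hx0 k) hk0 (hxeq k)
  have hkd := (hsum k).resolve_left hk0
  by_cases hz0 : ∑ v, x z v = 0
  · have h1 := h _ (x z) (hx0 z) hz0 (hxeq z)
    have h2 : 0 ≤ graphSpectrum G k := by rw [hkd]; positivity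
    rw [abs_of_nonneg h2]
    exact hmono.trans ((le_abs_self _).trans h1)
  have hzd := (hsum z).resolve_left hz0
  refine h _ (fun v => (∑ v, x k v) * x z v + -(∑ v, x z v) * x k v) (fun h0 => ?_) ?_ fun v => ?_
  · exact hk0 (hli z k _ _ hzk (congrFun h0)).1
  · rw [Finset.sum_add_distrib, ← Finset.mul_sum, ← Finset.mul_sum]
    ring
  · rw [Finset.sum_add_distrib, ← Finset.mul_sum, ← Finset.mul_sum, hxeq, hxeq, hkd, hzd]
    ring

end Spectrum

section SubsetOperator

variable {ι : Type*} [DecidableEq ι]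

lemma sum_powersetCard_swapSet (a b : ι) (S : Finset ι) (k : ℕ) (g : Finset ι → ℝ) :
    ∑ W ∈ S.powersetCard k, g (swapSet a b W) = ∑ W ∈ (swapSet a b S).powersetCard k, g W := by
  rw [swapSet, Finset.powersetCard_map, Finset.sum_map]
  rfl

lemma swapSet_union (a b : ι) (W Z : Finset ι) :
    swapSet a b (W ∪ Z) = swapSet a b W ∪ swapSet a b Z := Finset.map_union _ _

variable [Fintype ι]

/-- The functions on the `r`-subsets of `ι` with zero sum that are eigenfunctions with eigenvalue
`μ` of the operator summing over the `r`-subsets which contain `s` elements of the given set and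
`t` elements of its complement. -/
def eigenSubmodule (ι : Type*) [DecidableEq ι] [Fintype ι] (r s t : ℕ) (μ : ℝ) :
    Submodule ℝ (Finset ι → ℝ) where
  carrier := {F | (∀ S : Finset ι, S.card ≠ r → F S = 0) ∧
    (∑ S ∈ Finset.univ.powersetCard r, F S = 0) ∧
    ∀ S : Finset ι, S.card = r →
      ∑ W ∈ S.powersetCard s, ∑ Z ∈ Sᶜ.powersetCard t, F (W ∪ Z) = μ * F S}
  zero_mem' := by simp
  add_mem' := by
    rintro F G ⟨h1, h2, h3⟩ ⟨h1', h2', h3'⟩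
    refine ⟨fun S hS => ?_, ?_, fun S hS => ?_⟩
    · simp [h1 S hS, h1' S hS]
    · simp [Finset.sum_add_distrib, h2, h2']
    · simp [Finset.sum_add_distrib, h3 S hS, h3' S hS, mul_add]
  smul_mem' := by
    rintro a F ⟨h1, h2, h3⟩
    refine ⟨fun S hS => ?_, ?_, fun S hS => ?_⟩
    · simp [h1 S hS]
    · simp [← Finset.mul_sum, h2]
    · simp only [Pi.smul_apply, smul_eq_mul, ← Finset.mul_sum, h3 S hS]
      ring

lemma swapSet_compl (a b : ι) (S : Finset ι) : swapSet a b Sᶜ = (swapSet a b S)ᶜ := by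
  ext x; simp [mem_swapSet]

lemma swapSet_univ (a b : ι) : swapSet a b (Finset.univ : Finset ι) = Finset.univ := by
  ext x; simp [mem_swapSet]

lemma eigenSubmodule_swapSet {r s t : ℕ} {μ : ℝ} {F : Finset ι → ℝ}
    (hF : F ∈ eigenSubmodule ι r s t μ) (a b : ι) :
    (fun S => F (swapSet a b S)) ∈ eigenSubmodule ι r s t μ := by
  obtain ⟨h1, h2, h3⟩ := hF
  refine ⟨fun S hS => h1 _ (by rwa [card_swapSet]), ?_, fun S hS => ?_⟩
  · rw [sum_powersetCard_swapSet, swapSet_univ, h2]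
  · rw [← h3 _ (by rwa [card_swapSet]), ← sum_powersetCard_swapSet]
    refine Finset.sum_congr rfl fun W _ => ?_
    rw [← swapSet_compl, ← sum_powersetCard_swapSet]
    simp_rw [swapSet_union]

/-- The eigenvalues on the functions with zero sum are values of `pairSum`. -/
lemma exists_eq_pairSum {s t : ℕ} {μ : ℝ} (h : ∃ F ∈ eigenSubmodule ι (s + t) s t μ, F ≠ 0) :
    ∃ (X : Finset ι) (l : List (ι × ι)), X.card = s + t ∧ IsMatchingList l X Xᶜ ∧ l ≠ [] ∧
      μ = pairSum l X Xᶜ s t := by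
  obtain ⟨F, ⟨-, h2, h3⟩, X, l, hX, hFX, hl, hF⟩ := exists_mem_eq_mul_pairProd
    (eigenSubmodule ι (s + t) s t μ) (s + t) (fun F hF a b => eigenSubmodule_swapSet hF a b)
    (fun F hF => hF.1) h
  refine ⟨X, l, hX, hl, ?_, ?_⟩
  · rintro rfl
    rw [Finset.sum_congr rfl fun W hW => by
      rw [hF W (Finset.mem_powersetCard.1 hW).2, pairProd_nil, mul_one]] at h2
    rw [Finset.sum_const, nsmul_eq_mul, mul_eq_zero, Nat.cast_eq_zero, Finset.card_eq_zero] at h2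
    have hmem : X ∈ Finset.univ.powersetCard (s + t) := by simp [hX]
    rcases h2 with h2 | h2
    · simp [h2] at hmem
    · exact hFX h2
  · have := h3 X hX
    refine mul_right_cancel₀ hFX (this.symm.trans ?_)
    rw [pairSum, Finset.sum_mul]
    refine Finset.sum_congr rfl fun W hW => ?_
    rw [Finset.sum_mul]
    refine Finset.sum_congr rfl fun Z hZ => ?_
    rw [Finset.mem_powersetCard] at hW hZ
    have hd : Disjoint W Z := Finset.disjoint_of_subset_left hW.1
      (Finset.disjoint_of_subset_right hZ.1 disjoint_compl_right)
    rw [hF _ (by rw [Finset.card_union_of_disjoint hd, hW.2, hZ.2]), mul_comm]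
    congr 1
    refine pairProd_congr fun e he => ?_
    have h1 := (hl.mem e he).1
    have h2 := Finset.mem_compl.1 (hl.mem e he).2
    have h3 : e.1 ∉ Z := fun h' => Finset.mem_compl.1 (hZ.1 h') h1
    have h4 : e.2 ∉ W := fun h' => h2 (hW.1 h')
    simp [h3, h4]

end SubsetOperator

section Johnson

lemma sum_sq_fin_two {n : ℕ} (v : Fin n → Fin 2) :
    ∑ i, (v i : ℕ) ^ 2 = (Finset.univ.filter fun i => v i = 1).card := by
  rw [Finset.card_filter]
  refine Finset.sum_congr rfl fun i _ => ?_
  generalize v i = a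
  fin_cases a <;> simp

/-- Vertices of the Johnson graph correspond to `r`-subsets, by taking supports. -/
def vertexEquiv (n r : ℕ) : JohnsonVertex n r ≃ {S : Finset (Fin n) // S.card = r} where
  toFun v := ⟨Finset.univ.filter fun i => v.1 i = 1, by rw [← sum_sq_fin_two, v.2]⟩
  invFun S := ⟨fun i => if i ∈ S.1 then 1 else 0, by
    rw [sum_sq_fin_two]
    simp [S.2]⟩
  left_inv v := by
    ext i
    simp only [Finset.mem_filter, Finset.mem_univ, true_and]
    generalize v.1 i = a
    fin_cases a <;> simp
  right_inv S := by
    ext i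
    simp

lemma inner_eq_card_inter {n r : ℕ} (v w : JohnsonVertex n r) :
    ∑ i, (v.1 i : ℕ) * (w.1 i : ℕ) =
      ((vertexEquiv n r v).1 ∩ (vertexEquiv n r w).1).card := by
  have : (vertexEquiv n r v).1 ∩ (vertexEquiv n r w).1 =
      Finset.univ.filter fun i => v.1 i = 1 ∧ w.1 i = 1 := by
    ext i; simp [vertexEquiv]
  rw [this, Finset.card_filter]
  refine Finset.sum_congr rfl fun i _ => ?_
  generalize v.1 i = a
  generalize w.1 i = b
  fin_cases a <;> fin_cases b <;> simp

lemma sum_neighborFinset_johnsonGraph {n s t : ℕ} (ht : 0 < t) (v : JohnsonVertex n (s + t))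
    (g : Finset (Fin n) → ℝ) :
    ∑ w ∈ (johnsonGraph n (s + t) s).neighborFinset v, g (vertexEquiv n (s + t) w).1 =
      ∑ W ∈ (vertexEquiv n (s + t) v).1.powersetCard s,
        ∑ Z ∈ (vertexEquiv n (s + t) v).1ᶜ.powersetCard t, g (W ∪ Z) := by
  set φ := vertexEquiv n (s + t)
  set X := (φ v).1
  have hX : X.card = s + t := (φ v).2
  have hadj : ∀ w, w ∈ (johnsonGraph n (s + t) s).neighborFinset v ↔ ((φ w).1 ∩ X).card = s := by
    intro w
    rw [SimpleGraph.mem_neighborFinset]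
    change (v ≠ w ∧ _) ↔ _
    rw [inner_eq_card_inter, Finset.inter_comm]
    refine ⟨fun h => h.2, fun h => ⟨?_, h⟩⟩
    rintro rfl
    change (X ∩ X).card = s at h
    rw [Finset.inter_self, hX] at h
    omega
  rw [← Finset.sum_product']
  have hcard : ∀ p ∈ X.powersetCard s ×ˢ Xᶜ.powersetCard t,
      (p.1 ∪ p.2).card = s + t ∧ (p.1 ∪ p.2) ∩ X = p.1 ∧ (p.1 ∪ p.2) \ X = p.2 := by
    rintro ⟨W, Z⟩ hp
    simp only [Finset.mem_product, Finset.mem_powersetCard] at hp ⊢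
    obtain ⟨⟨hW, hWs⟩, hZ, hZt⟩ := hp
    have hd : Disjoint W Z := Finset.disjoint_of_subset_left hW
      (Finset.disjoint_of_subset_right hZ disjoint_compl_right)
    have hZ' : ∀ i ∈ Z, i ∉ X := fun i hi => Finset.mem_compl.1 (hZ hi)
    refine ⟨by rw [Finset.card_union_of_disjoint hd, hWs, hZt], ?_, ?_⟩
    · ext i
      have h1 := @hW i
      have h2 := hZ' i
      simp only [Finset.mem_inter, Finset.mem_union]
      tauto
    · ext i
      have h1 := @hW i
      have h2 := hZ' i
      simp only [Finset.mem_sdiff, Finset.mem_union]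
      tauto
  refine Finset.sum_bij' (fun w _ => ((φ w).1 ∩ X, (φ w).1 \ X))
    (fun p hp => φ.symm ⟨p.1 ∪ p.2, (hcard p hp).1⟩) ?_ ?_ ?_ ?_ ?_
  · intro w hw
    rw [hadj] at hw
    have h1 := Finset.card_inter_add_card_sdiff (φ w).1 X
    have h2 := (φ w).2
    simp only [Finset.mem_product, Finset.mem_powersetCard]
    refine ⟨⟨Finset.inter_subset_right, hw⟩, fun i hi => ?_, by omega⟩
    exact Finset.mem_compl.2 (Finset.mem_sdiff.1 hi).2
  · intro p hp
    rw [hadj, Equiv.apply_symm_apply, (hcard p hp).2.1]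
    exact (Finset.mem_powersetCard.1 (Finset.mem_product.1 hp).1).2
  · intro w hw
    rw [Equiv.symm_apply_eq]
    ext i
    simp only [Finset.mem_union, Finset.mem_inter, Finset.mem_sdiff]
    tauto
  · intro p hp
    simp only [Equiv.apply_symm_apply]
    exact Prod.ext (hcard p hp).2.1 (hcard p hp).2.2
  · intro w hw
    congr 1
    ext i
    simp only [Finset.mem_union, Finset.mem_inter, Finset.mem_sdiff]
    tauto

lemma isRegularOfDegree_johnsonGraph {n s t : ℕ} (ht : 0 < t) :
    (johnsonGraph n (s + t) s).IsRegularOfDegree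
      ((s + t).choose s * (n - (s + t)).choose t) := by
  intro v
  have h := sum_neighborFinset_johnsonGraph ht v (fun _ => 1)
  have hX := (vertexEquiv n (s + t) v).2
  simp only [Finset.sum_const, Finset.card_powersetCard, Finset.card_compl, Fintype.card_fin, hX,
    SimpleGraph.card_neighborFinset_eq_degree, nsmul_eq_mul, mul_one] at h
  exact_mod_cast h

/-- A uniform bound on the values of `pairSum` bounds the second eigenvalue. -/
lemma secondEigenvalue_johnsonGraph_le {n s t : ℕ} (ht : 0 < t) {B : ℝ} (hB : 0 ≤ B)
    (h : ∀ (X : Finset (Fin n)) (l : List (Fin n × Fin n)), X.card = s + t →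
      IsMatchingList l X Xᶜ → l ≠ [] → |pairSum l X Xᶜ s t| ≤ B) :
    secondEigenvalue (johnsonGraph n (s + t) s) ≤ B := by
  refine secondEigenvalue_le _ (isRegularOfDegree_johnsonGraph ht) hB fun μ x hx hsum heig => ?_
  set φ := vertexEquiv n (s + t)
  set F : Finset (Fin n) → ℝ := fun S => if hS : S.card = s + t then x (φ.symm ⟨S, hS⟩) else 0
  have hFφ : ∀ v, F (φ v).1 = x v := fun v => by
    simp only [F, dif_pos (φ v).2, Subtype.coe_eta, Equiv.symm_apply_apply]
  have hφ : ∀ S : Finset (Fin n), S.card = s + t → ∃ v, (φ v).1 = S := fun S hS =>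
    ⟨φ.symm ⟨S, hS⟩, by rw [Equiv.apply_symm_apply]⟩
  obtain ⟨X, l, hX, hl, hne, rfl⟩ := exists_eq_pairSum (ι := Fin n) (s := s) (t := t) (μ := μ) (by
    refine ⟨F, ⟨fun S hS => dif_neg hS, ?_, fun S hS => ?_⟩, fun h0 => hx ?_⟩
    · rw [← hsum]
      symm
      refine Finset.sum_bij (fun v _ => (φ v).1) (fun v _ => ?_) (fun v _ w _ hvw => ?_)
        (fun S hS => ?_) fun v _ => (hFφ v).symm
      · simp [(φ v).2]
      · exact φ.injective (Subtype.ext hvw)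
      · obtain ⟨v, hv⟩ := hφ S (Finset.mem_powersetCard.1 hS).2
        exact ⟨v, Finset.mem_univ v, hv⟩
    · obtain ⟨v, rfl⟩ := hφ S hS
      rw [← sum_neighborFinset_johnsonGraph ht v F, hFφ, ← heig v]
      exact Finset.sum_congr rfl fun w _ => hFφ w
    · funext v
      rw [← hFφ v, h0]
      rfl)
  exact h X l hX hl hne

end Johnson

section Asymptotics

lemma abs_pairSum_le_of_proportional {n s t v : ℕ} {c : ℝ} (hc : 0 < c) (hc1 : c ≤ 1)
    (hn : 0 < n) (hnv : n = s + t + (t + v)) (hs : 2 * c * n ≤ s) (ht : 2 * c * n ≤ t)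
    (hv : 2 * c * n ≤ v) (X : Finset (Fin n)) (l : List (Fin n × Fin n)) (hX : X.card = s + t)
    (hl : IsMatchingList l X Xᶜ) (hne : l ≠ []) :
    |pairSum l X Xᶜ s t| ≤
      (|(s : ℝ) / (s + t : ℕ) - t / (t + v : ℕ)| + 2 / (c ^ 3 * n)) *
        ((s + t).choose s * (t + v).choose t) := by
  have hn' : (0 : ℝ) < n := by exact_mod_cast hn
  have hcn : 0 < c * n := mul_pos hc hn'
  have hXc : Xᶜ.card = t + v := by rw [Finset.card_compl, hX, Fintype.card_fin]; omega
  have hXn : (X.card : ℝ) ≤ n := by rw [hX]; exact_mod_cast (by omega)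
  have hXcn : (Xᶜ.card : ℝ) ≤ n := by rw [hXc]; exact_mod_cast (by omega)
  have hc2 : 0 < c ^ 2 := by positivity
  have hc21 : c ^ 2 ≤ 1 := pow_le_one₀ hc.le hc1
  set m := ⌊c * n⌋₊
  have hm : (m : ℝ) ≤ c * n := Nat.floor_le hcn.le
  have hm1 : c * n < m + 1 := Nat.lt_floor_add_one _
  have hle : ∀ k : ℕ, (1 - c ^ 2) ^ k ≤ 1 := fun k =>
    pow_le_one₀ (by linarith) (by linarith)
  by_cases hlen : l.length ≤ m + 1
  · obtain ⟨j, hj⟩ : ∃ j, l.length = j + 1 :=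
      Nat.exists_eq_succ_of_ne_zero (by simpa using hne)
    have hjm : (j : ℝ) ≤ m := by exact_mod_cast (by omega : j ≤ m)
    have h := abs_pairSum_le_density hc hc1 hn' j l X Xᶜ s t t v hl hX hXc hj hXn hXcn
      (by linarith) (by linarith) (by linarith) (by linarith)
    rw [hX, hXc] at h
    refine h.trans (mul_le_mul_of_nonneg_right ?_ (by positivity))
    rw [mul_add]
    refine add_le_add (mul_le_of_le_one_left (abs_nonneg _) (hle j)) ?_
    calc (1 - c ^ 2) ^ j * (j * (2 / (c * n))) = (j * (1 - c ^ 2) ^ j) * (2 / (c * n)) := by ring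
      _ ≤ 1 / c ^ 2 * (2 / (c * n)) :=
        mul_le_mul_of_nonneg_right (nat_mul_pow_le hc2 hc21 j) (by positivity)
      _ = 2 / (c ^ 3 * n) := by field_simp
  · have h := abs_pairSum_le_pow hc hc1 hn' m l X Xᶜ s t t v hl hX hXc (by omega) hXn hXcn
      (by linarith) (by linarith) (by linarith) (by linarith)
    rw [hX, hXc] at h
    refine h.trans (mul_le_mul_of_nonneg_right ?_ (by positivity))
    have h1 : (1 - c ^ 2) ^ m ≤ 2 / (c ^ 3 * n) := by
      have h2 := nat_mul_pow_le hc2 hc21 m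
      have h3 : 1 ≤ 1 / c ^ 2 := by rwa [le_div_iff₀ hc2, one_mul]
      have h4 : 0 ≤ (1 - c ^ 2) ^ m := pow_nonneg (by linarith) m
      have h5 : (1 - c ^ 2) ^ m * (c * n) ≤ 2 / c ^ 2 := by
        calc (1 - c ^ 2) ^ m * (c * n) ≤ (1 - c ^ 2) ^ m * (m + 1) :=
              mul_le_mul_of_nonneg_left hm1.le h4
          _ = m * (1 - c ^ 2) ^ m + (1 - c ^ 2) ^ m := by ring
          _ ≤ 1 / c ^ 2 + 1 / c ^ 2 := add_le_add h2 ((hle m).trans h3)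
          _ = 2 / c ^ 2 := by ring
      rw [← le_div_iff₀ hcn] at h5
      refine h5.trans_eq ?_
      field_simp
    exact h1.trans (le_add_of_nonneg_left (abs_nonneg _))

lemma abs_density_sub_le {c α n r s a b : ℝ} (hc : 0 < c) (hn : 0 < n) (hr : r = α * n + a)
    (hs : s = α ^ 2 * n + b) (hrn : c * n ≤ r) (hnr : c * n ≤ n - r) :
    |s / r - (r - s) / (n - r)| ≤
      2 / c ^ 2 * (max 1 (max |b - 2 * α * a| (a ^ 2 / n)) / n) := by
  set M := max 1 (max |b - 2 * α * a| (a ^ 2 / n))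
  have hcn : 0 < c * n := mul_pos hc hn
  have hM1 : |b - 2 * α * a| ≤ M := (le_max_left _ _).trans (le_max_right _ _)
  have hM2 : a ^ 2 / n ≤ M := (le_max_right _ _).trans (le_max_right _ _)
  have hM0 : 0 ≤ M := zero_le_one.trans (le_max_left _ _)
  have hr0 : 0 < r := hcn.trans_le hrn
  have hnr0 : 0 < n - r := hcn.trans_le hnr
  have e : s * (n - r) - r * (r - s) = n * (b - 2 * α * a) - a ^ 2 := by
    rw [hr, hs]; ring
  rw [div_sub_div _ _ hr0.ne' hnr0.ne', e, abs_div, abs_of_pos (mul_pos hr0 hnr0)]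
  have hnum : |n * (b - 2 * α * a) - a ^ 2| ≤ 2 * n * M := by
    refine (abs_sub _ _).trans ?_
    rw [abs_mul, abs_of_pos hn, abs_of_nonneg (sq_nonneg a)]
    rw [div_le_iff₀ hn] at hM2
    nlinarith [mul_le_mul_of_nonneg_left hM1 hn.le]
  calc |n * (b - 2 * α * a) - a ^ 2| / (r * (n - r)) ≤ 2 * n * M / ((c * n) * (c * n)) :=
        div_le_div₀ (by positivity) hnum (by positivity)
          (mul_le_mul hrn hnr hcn.le hr0.le)
    _ = 2 / c ^ 2 * (M / n) := by field_simp

end Asymptotics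

theorem theorem6 (α : ℝ) (hα₀ : 0 < α) (hα₁ : α < 1) (f_r f_s : ℕ → ℝ)
    (hf_r : f_r =o[atTop] (fun n : ℕ => (n : ℝ)))
    (hf_s : f_s =o[atTop] (fun n : ℕ => (n : ℝ))) :
    ∃ C : ℝ, ∀ᶠ n : ℕ in atTop, ∀ r s : ℕ,
      (r : ℝ) = α * n + f_r n → (s : ℝ) = α ^ 2 * n + f_s n →
        ∃ d : ℕ, (johnsonGraph n r s).IsRegularOfDegree d ∧
          secondEigenvalue (johnsonGraph n r s) ≤
            C * (max 1 (max |f_s n - 2 * α * f_r n| (f_r n ^ 2 / n)) / n * d) := by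
  obtain ⟨c, hc, h1, h2, h3⟩ : ∃ c : ℝ, 0 < c ∧ 5 * c ≤ α ^ 2 ∧ 5 * c ≤ α * (1 - α) ∧
      5 * c ≤ (1 - α) ^ 2 := by
    have hα' : 0 < 1 - α := by linarith
    refine ⟨min (α ^ 2) (min (α * (1 - α)) ((1 - α) ^ 2)) / 5, by positivity, ?_, ?_, ?_⟩ <;>
      rw [mul_div_cancel₀ _ (by norm_num : (5 : ℝ) ≠ 0)]
    · exact min_le_left _ _
    · exact (min_le_right _ _).trans (min_le_left _ _)
    · exact (min_le_right _ _).trans (min_le_right _ _)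
  have hc1 : c ≤ 1 := by nlinarith
  refine ⟨2 / c ^ 2 + 2 / c ^ 3, ?_⟩
  filter_upwards [hf_r.bound hc, hf_s.bound hc, eventually_gt_atTop 0] with n hfr hfs hn r s hr hs
  have hn' : (0 : ℝ) < n := by exact_mod_cast hn
  have hcn : 0 < c * n := mul_pos hc hn'
  rw [Real.norm_eq_abs, Real.norm_of_nonneg hn'.le, abs_le] at hfr hfs
  have g1 := mul_le_mul_of_nonneg_right h1 hn'.le
  have g2 := mul_le_mul_of_nonneg_right h2 hn'.le
  have g3 := mul_le_mul_of_nonneg_right h3 hn'.le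
  have hs4 : 2 * c * n ≤ s := by rw [hs]; nlinarith
  have ht3 : 2 * c * n ≤ (r : ℝ) - s := by rw [hr, hs]; nlinarith
  have hv2 : 2 * c * n ≤ (n : ℝ) - 2 * r + s := by rw [hr, hs]; nlinarith
  obtain ⟨t, rfl⟩ : ∃ t, r = s + t := Nat.exists_eq_add_of_le (by
    have : (s : ℝ) ≤ r := by linarith
    exact_mod_cast this)
  obtain ⟨v, hv⟩ : ∃ v, n = s + t + t + v := Nat.exists_eq_add_of_le (by
    have : ((s + t + t : ℕ) : ℝ) ≤ n := by push_cast at hv2 ⊢; linarith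
    exact_mod_cast this)
  have hvn : (n : ℝ) = s + t + t + v := by exact_mod_cast hv
  push_cast at ht3 hv2
  have ht : 0 < t := by
    have : (0 : ℝ) < t := by linarith
    exact_mod_cast this
  have hnr : n - (s + t) = t + v := by omega
  refine ⟨_, isRegularOfDegree_johnsonGraph ht, ?_⟩
  rw [hnr]
  have hdens := abs_density_sub_le hc hn' hr hs (by push_cast; linarith) (by push_cast; linarith)
  set M := max 1 (max |f_s n - 2 * α * f_r n| (f_r n ^ 2 / n))
  have hM1 : 1 ≤ M := le_max_left _ _
  refine secondEigenvalue_johnsonGraph_le ht (by positivity) fun X l hX hl hne => ?_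
  refine (abs_pairSum_le_of_proportional (v := v) hc hc1 hn (by omega) hs4
    (by linarith) (by linarith) X l hX hl hne).trans ?_
  push_cast
  rw [← mul_assoc (2 / c ^ 2 + 2 / c ^ 3)]
  refine mul_le_mul_of_nonneg_right ?_ (by positivity)
  rw [add_mul]
  refine add_le_add ?_ ?_
  · have e1 : ((s + t : ℕ) : ℝ) - s = t := by push_cast; ring
    have e2 : (n : ℝ) - (s + t : ℕ) = t + v := by rw [hvn]; push_cast; ring
    rw [e1, e2] at hdens
    exact_mod_cast hdens
  · calc 2 / (c ^ 3 * n) = 2 / c ^ 3 * (1 / n) := by field_simp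
      _ ≤ 2 / c ^ 3 * (M / n) := by gcongr
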